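/- **Definitions.** Let $X\subseteq\mathbb R$. - $X$ is a *Delone set* if it is uniformly discrete (there is $s>0$ such that distinct points of $X$ are at distance more than $s$) and relatively dense (there is $\rho>0$ such that every real number lies within $\rho$ of a point of $X$). Its *covering radius* $R_X$ is the least $\rho$ such that every real number lies within distance $\rho$ of a point of $X$. - $X$ is a *Meyer set* if both $X$ and $X-X=\{x-y: x,y\in X\}$ are Delone sets. - $X$ is *aperiodic* if $X+t=X$ holds only for $t=0$. - For $T>0$ and $x\in X$, the *$T$-patch* of $X$ centered at $x$ is $\mathcal P_X(x;T)=X\cap(x-T,x+T)$. The $T$-patches centered at $x,y\in X$ are *equivalent* if $\mathcal P_X(y;T)=\mathcal P_X(x;T)+y-x$. - $N_X(T)$ is the number (possibly infinite) of inequivalent $T$-patches of $X$. - $M_X(T)$ is the least $M$ (possibly infinite) such that for every $x\in X$ every closed interval $[c-M,c+M]$ contains a point of $X$ that is the center of a $T$-patch equivalent to $\mathcal P_X(x;T)$. - $X$ is *linearly repetitive* if for every $T_1>0$ there is a constant $c$ with $M_X(T)<cT$ for all $T\ge T_1$. Let $\tau=\frac12(1+\sqrt5)$, and let $\langle x\rangle=x-\lfloor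 x\rfloor$ be the fractional part of $x$. **Theorem.** For each $\epsilon>0$ there is a real number $\delta$ with $|\delta|<\frac12$ such that the set $$Y=\{m+\delta\langle m\tau\rangle : m\in\mathbb Z\}\subset\mathbb R,$$ with covering radius $R=R_Y$, is an aperiodic, linearly repetitive Meyer set and has the following properties. (i) There is a $T^*>0$ with $$N_Y(T^*)<\Bigl(\frac12+\epsilon\Bigr)\frac{T^*}{R}\quad\text{and}\quad M_Y(T^*)<\Bigl(\frac12+\epsilon\Bigr)T^*.$$ (ii) There is a $T_0>0$ such that, for all $T>T_0$, $$N_Y(T)<(1+\epsilon)\frac{T}{R}\quad\text{and}\quad M_Y(T)<(\tau+1+\epsilon)T.$$ -/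

import Mathlib

open scoped Pointwise ENNReal

/-- `X` is a Delone set: uniformly discrete and relatively dense. -/
def IsDelone {E : Type*} [NormedAddCommGroup E] (X : Set E) : Prop :=
  ∃ D : Delone.DeloneSet E, D.carrier = X

/-- A Meyer set is a Delone set whose set of differences is also a Delone set. -/
def IsMeyer {E : Type*} [NormedAddCommGroup E] (X : Set E) : Prop :=
  IsDelone X ∧ IsDelone (X - X)

/-- `X` has no non-zero translation symmetry. -/
def IsAperiodic {E : Type*} [NormedAddCommGroup E] (X : Set E) : Prop :=
  ∀ t : E, t +ᵥ X = X → t = 0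

/-- The covering radius: the least `R` (possibly infinite) such that the closed balls of
radius `R` centered at the points of `X` cover the space. -/
noncomputable def coveringRadius {E : Type*} [NormedAddCommGroup E] (X : Set E) : ℝ≥0∞ :=
  sInf {R : ℝ≥0∞ | ∀ c : E, ∃ y ∈ X, edist y c ≤ R}

/-- The `T`-patch of `X` centered at `x`; the ball is open. -/
def patch {E : Type*} [NormedAddCommGroup E] (X : Set E) (T : ℝ) (x : E) : Set E :=
  X ∩ Metric.ball x T

/-- Translation equivalence of the `T`-patches centered at `x` and `y`:
the translation carrying the center `x` to the center `y` carries one patch to the other. -/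
def PatchEquiv {E : Type*} [NormedAddCommGroup E] (X : Set E) (T : ℝ) (x y : E) : Prop :=
  patch X T y = (y - x) +ᵥ patch X T x

/-- Translation equivalence of `T`-patches, as an equivalence relation on their centers. -/
def patchSetoid {E : Type*} [NormedAddCommGroup E] (X : Set E) (T : ℝ) : Setoid X where
  r x y := PatchEquiv X T (x : E) (y : E)
  iseqv :=
    { refl := fun x => by simp [PatchEquiv]
      symm := fun {x y} h => by
        unfold PatchEquiv at h ⊢
        rw [h, vadd_vadd]
        simp
      trans := fun {x y z} h h' => by
        unfold PatchEquiv at h h' ⊢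
        rw [h', h, vadd_vadd]
        simp }

/-- The patch-counting function: the number (possibly infinite) of
translation-inequivalent `T`-patches centered at points of `X`. -/
noncomputable def patchCount {E : Type*} [NormedAddCommGroup E] (X : Set E) (T : ℝ) : ℕ∞ :=
  ENat.card (Quotient (patchSetoid X T))

/-- The repetitivity function: the least `M` (possibly infinite) such that every closed ball
of radius `M` contains, for every `T`-patch of `X`, the center of a `T`-patch of `X`
that is translation equivalent to it. -/
noncomputable def repetitivity {E : Type*} [NormedAddCommGroup E] (X : Set E) (T : ℝ) : ℝ≥0∞ :=
  sInf {M : ℝ≥0∞ | ∀ c : E, ∀ x ∈ X, ∃ y ∈ X, edist y c ≤ M ∧ PatchEquiv X T x y}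

/-- Linear repetitivity: the repetitivity function is bounded by a linear function `c * T` of
the radius, on every range of radii bounded away from `0`. (As `T` tends to `0` the
repetitivity function tends to the covering radius, which is positive for a Delone set in a
nontrivial space, so that no bound `c * T` can hold for arbitrarily small `T`.) -/
def IsLinearlyRepetitive {E : Type*} [NormedAddCommGroup E] (X : Set E) : Prop :=
  ∀ T₁ : ℝ, 0 < T₁ → ∃ c : ℝ, ∀ T : ℝ, T₁ ≤ T → repetitivity X T < ENNReal.ofReal (c * T)

/-! Write `φ` for the golden ratio. For `δ > 0` the differences of points of the set are determined
by increments of the Beatty sequence `⌊m φ⌋`, so a `T`-patch is coded by about `2 T` consecutive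
increments. Counting: as `⟨m φ⟩` grows, each increment jumps at most once, so only `2 n + 1`
patterns of radius `n` occur (`exists_floor_pattern_invariant`). Recurrence: a pattern occurs when
`m φ` lies, modulo one, in an interval of length `|d φ - p|` with `|d| ≤ 2 n`. Best approximation
bounds this length below, and Fibonacci windows of multiples of `φ` hit every interval that long
(`exists_floor_pattern_recurs`). Since `2 n` can fall just above a Fibonacci number, the recurrence
constant is `φ + 1`. The constant `1/2` in (i) comes from `T` just below `1`, where patches are
still singletons and both the covering radius and the repetitivity are at most `(1 + δ) / 2`. -/

namespace DisplacedLattice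

open Real

/-! ### Diophantine approximation of the golden ratio -/

/-- Consecutive powers of `-ψ = 1/φ`. -/
lemma neg_goldenConj_pow (k : ℕ) :
    (-goldenConj) ^ k = (-goldenConj) ^ (k + 1) + (-goldenConj) ^ (k + 2) := by
  have h := goldenConj_sq
  rw [pow_add _ k 2, pow_succ, neg_sq, h]
  ring

lemma neg_goldenConj_pos : 0 < -goldenConj := neg_pos.2 goldenConj_neg

/-- Any window of `fib (k + 2)` consecutive multiples of `φ` meets, modulo one, every half-open
interval of length `φ⁻¹ ^ k`. -/
lemma exists_int_mul_goldenRatio_mem_Ico (k : ℕ) (u : ℝ) (a : ℤ) :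
    ∃ m p : ℤ, a ≤ m ∧ m < a + Nat.fib (k + 2) ∧
      u ≤ m * goldenRatio - p ∧ m * goldenRatio - p < u + (-goldenConj) ^ k := by
  induction k generalizing u with
  | zero =>
    refine ⟨a, ⌊a * goldenRatio - u⌋, le_rfl, by simp, ?_, ?_⟩
    · linarith [Int.floor_le (a * goldenRatio - u)]
    · have := Int.lt_floor_add_one (a * goldenRatio - u)
      simp only [pow_zero]
      linarith
  | succ k ih =>
    have hstep := fib_succ_sub_goldenRatio_mul_fib (k + 1)
    have hk := neg_goldenConj_pow k
    have hp1 : 0 < (-goldenConj) ^ (k + 1) := pow_pos neg_goldenConj_pos _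
    have hp2 : 0 < (-goldenConj) ^ (k + 2) := pow_pos neg_goldenConj_pos _
    have hle : (-goldenConj) ^ (k + 2) ≤ (-goldenConj) ^ (k + 1) :=
      pow_le_pow_of_le_one neg_goldenConj_pos.le (by linarith [neg_one_lt_goldenConj]) (by omega)
    have hfib : (Nat.fib (k + 1 + 2) : ℤ) = Nat.fib (k + 1) + Nat.fib (k + 2) := by
      exact_mod_cast Nat.fib_add_two (n := k + 1)
    -- Adding `fib (k + 1)` to `m` and `fib (k + 2)` to `p` moves `m φ - p` by `φ⁻¹ ^ (k + 1)`, to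
    -- the left for even `k + 1` and to the right for odd. A point of the longer interval that
    -- misses the target is thereby moved into it; in the odd case the longer interval must extend
    -- to the left of `u`.
    rcases Nat.even_or_odd (k + 1) with hpar | hpar
    · have he : goldenConj ^ (k + 1) = (-goldenConj) ^ (k + 1) := (hpar.neg_pow _).symm
      obtain ⟨m, p, h1, h2, h3, h4⟩ := ih u
      by_cases hin : m * goldenRatio - p < u + (-goldenConj) ^ (k + 1)
      · exact ⟨m, p, h1, by omega, h3, hin⟩
      · refine ⟨m + Nat.fib (k + 1), p + Nat.fib (k + 1 + 1), by omega, by omega, ?_, ?_⟩ <;>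
          push_cast <;> linarith
    · have he : goldenConj ^ (k + 1) = -(-goldenConj) ^ (k + 1) := by
        rw [hpar.neg_pow, neg_neg]
      obtain ⟨m, p, h1, h2, h3, h4⟩ := ih (u - (-goldenConj) ^ (k + 2))
      by_cases hin : u ≤ m * goldenRatio - p
      · exact ⟨m, p, h1, by omega, hin, by linarith⟩
      · refine ⟨m + Nat.fib (k + 1), p + Nat.fib (k + 1 + 1), by omega, by omega, ?_, ?_⟩ <;>
          push_cast <;> linarith

/-- Cassini's identity, up to sign. -/
lemma exists_mul_fib_sq_sub_eq_one (k : ℕ) :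
    ∃ s : ℤ, s * ((Nat.fib (k + 1) : ℤ) ^ 2 - Nat.fib k * Nat.fib (k + 2)) = 1 := by
  induction k with
  | zero => exact ⟨1, by norm_num⟩
  | succ k ih =>
    obtain ⟨s, hs⟩ := ih
    refine ⟨-s, ?_⟩
    rw [Nat.fib_add_two (n := k + 1)]
    rw [Nat.fib_add_two (n := k)] at hs ⊢
    push_cast at hs ⊢
    linear_combination hs

/-- Best approximation property of the Fibonacci numbers: `|d φ - p| ≥ φ⁻¹ ^ k` whenever
`|d| < fib (k + 1)` and `(d, p) ≠ 0`. -/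
lemma le_abs_int_mul_goldenRatio_sub (k : ℕ) (d p : ℤ) (hd : |d| < Nat.fib (k + 1))
    (h0 : d ≠ 0 ∨ p ≠ 0) : (-goldenConj) ^ k ≤ |d * goldenRatio - p| := by
  by_cases hd0 : d = 0
  · subst hd0
    have hp : p ≠ 0 := by simpa using h0
    have h1 : (1 : ℝ) ≤ |(p : ℝ)| := by exact_mod_cast Int.one_le_abs hp
    have h2 : (-goldenConj) ^ k ≤ 1 :=
      pow_le_one₀ neg_goldenConj_pos.le (by linarith [neg_one_lt_goldenConj])
    simpa using h2.trans h1
  -- coordinates of `(d, p)` in the unimodular basis of consecutive convergents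
  obtain ⟨s, hcas⟩ := exists_mul_fib_sq_sub_eq_one k
  have hfib : (Nat.fib (k + 2) : ℤ) = Nat.fib k + Nat.fib (k + 1) := by
    exact_mod_cast Nat.fib_add_two (n := k)
  have hf0 : (0 : ℤ) ≤ Nat.fib k := by positivity
  have hf1 : (1 : ℤ) ≤ Nat.fib (k + 1) := by exact_mod_cast Nat.fib_pos.2 (Nat.succ_pos k)
  set f : ℤ := ((Nat.fib k : ℕ) : ℤ) with hf
  set g : ℤ := ((Nat.fib (k + 1) : ℕ) : ℤ) with hg
  obtain ⟨u, v, hu, hv⟩ : ∃ u v : ℤ, d = u * f + v * g ∧ p = u * g + v * (f + g) := by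
    refine ⟨s * (p * g - d * (f + g)), s * (d * g - p * f), ?_, ?_⟩
    · rw [hfib] at hcas; linear_combination (-d) * hcas
    · rw [hfib] at hcas; linear_combination (-p) * hcas
  have hθ : d * goldenRatio - p = -(u * goldenConj ^ k + v * goldenConj ^ (k + 1)) := by
    have e1 : (g : ℝ) - goldenRatio * f = goldenConj ^ k := by
      have := fib_succ_sub_goldenRatio_mul_fib k
      rw [hf, hg]; exact_mod_cast this
    have e2 : ((f : ℝ) + g) - goldenRatio * g = goldenConj ^ (k + 1) := by
      have := fib_succ_sub_goldenRatio_mul_fib (k + 1)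
      rw [← this, ← Int.cast_add, ← hfib, hg]
      push_cast; ring
    rw [← e1, ← e2, hu, hv]
    push_cast
    ring
  have hfac : |d * goldenRatio - p| = (-goldenConj) ^ k * |u + v * goldenConj| := by
    rw [hθ, abs_neg, show u * goldenConj ^ k + v * goldenConj ^ (k + 1)
      = goldenConj ^ k * (u + v * goldenConj) by ring, abs_mul, abs_pow, abs_of_neg goldenConj_neg]
  have hu0 : u ≠ 0 := by
    rintro rfl
    have hv0 : v ≠ 0 := by rintro rfl; simp at hu; exact hd0 hu
    have : g ≤ |d| := by
      rw [hu, zero_mul, zero_add, abs_mul, abs_of_pos (by omega : 0 < g)]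
      nlinarith [Int.one_le_abs hv0]
    omega
  -- `|d| < g` prevents `u` and `v` from having the same sign; as `ψ < 0`, the two terms then
  -- reinforce each other.
  have hone : 1 ≤ |u + v * goldenConj| := by
    have hψ := goldenConj_neg
    rw [abs_lt] at hd
    rcases lt_or_gt_of_ne hu0 with h | h
    · have hvn : 0 ≤ v := by
        by_contra hvn
        nlinarith
      have h' : (u : ℝ) ≤ -1 := by exact_mod_cast (by omega : u ≤ -1)
      have hv' : (0 : ℝ) ≤ v := by exact_mod_cast hvn
      rw [le_abs]; right; nlinarith
    · have hvn : v ≤ 0 := by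
        by_contra hvn
        nlinarith
      have h' : (1 : ℝ) ≤ u := by exact_mod_cast (by omega : 1 ≤ u)
      have hv' : (v : ℝ) ≤ 0 := by exact_mod_cast hvn
      rw [le_abs]; left; nlinarith
  rw [hfac]
  exact le_mul_of_one_le_right (pow_nonneg neg_goldenConj_pos.le _) hone

/-! ### Patterns of the Beatty sequence -/

/-- Every pattern of `2 n + 1` consecutive terms of the Beatty sequence `⌊m φ⌋` recurs, up to an
additive constant, in any window of `fib (k + 2)` consecutive integers, where
`2 n < fib (k + 1)`. -/
lemma exists_floor_pattern_recurs (n k : ℕ) (hk : 2 * n < Nat.fib (k + 1)) (m a : ℤ) :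
    ∃ m' q : ℤ, a ≤ m' ∧ m' < a + Nat.fib (k + 2) ∧ ∀ j : ℤ, |j| ≤ n →
      ⌊((m' + j : ℤ) : ℝ) * goldenRatio⌋ = ⌊((m + j : ℤ) : ℝ) * goldenRatio⌋ + q := by
  have hne : (Finset.Icc (-n : ℤ) n).Nonempty := ⟨0, by simp⟩
  -- The pattern at `m` is the system `w j ≤ m φ < w j + 1`, that is, `m φ ∈ [max w, min w + 1)`.
  set w : ℤ → ℝ := fun j => ⌊((m + j : ℤ) : ℝ) * goldenRatio⌋ - j * goldenRatio with hw
  obtain ⟨i, hi, hmax⟩ := Finset.exists_max_image _ w hne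
  obtain ⟨l, hl, hmin⟩ := Finset.exists_min_image _ w hne
  rw [Finset.mem_Icc] at hi hl
  have hi' : w i ≤ m * goldenRatio := by
    have := Int.floor_le (((m + i : ℤ) : ℝ) * goldenRatio)
    simp only [hw]; push_cast at this ⊢; linarith
  have hl' : m * goldenRatio < w l + 1 := by
    have := Int.lt_floor_add_one (((m + l : ℤ) : ℝ) * goldenRatio)
    simp only [hw]; push_cast at this ⊢; linarith
  -- The interval has positive length of the form `d φ - p` with `|d| ≤ 2 n`, so best approximation
  -- applies.
  have hlen : w i + (-goldenConj) ^ k ≤ w l + 1 := by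
    have heq : w l + 1 - w i = ((i - l : ℤ) : ℝ) * goldenRatio -
        ((⌊((m + i : ℤ) : ℝ) * goldenRatio⌋ - ⌊((m + l : ℤ) : ℝ) * goldenRatio⌋ - 1 : ℤ) : ℝ) := by
      simp only [hw]; push_cast; ring
    have hpos : 0 < w l + 1 - w i := by linarith
    have := le_abs_int_mul_goldenRatio_sub k (i - l)
      (⌊((m + i : ℤ) : ℝ) * goldenRatio⌋ - ⌊((m + l : ℤ) : ℝ) * goldenRatio⌋ - 1)
      (by rw [abs_lt]; omega) (by
        by_contra! h
        rw [h.1, h.2] at heq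
        simp at heq
        linarith)
    rw [← heq, abs_of_pos hpos] at this
    linarith
  obtain ⟨m', p, h1, h2, h3, h4⟩ := exists_int_mul_goldenRatio_mem_Ico k (w i) a
  refine ⟨m', p, h1, h2, fun j hj => ?_⟩
  have hj' : j ∈ Finset.Icc (-n : ℤ) n := by rw [Finset.mem_Icc]; exact abs_le.1 hj
  have e1 := hmax j hj'
  have e2 := hmin j hj'
  rw [Int.floor_eq_iff]
  simp only [hw] at e1 e2 h3 h4 hlen
  push_cast at e1 e2 h3 h4 hlen ⊢
  constructor <;> linarith

/-- The patterns of `2 n + 1` consecutive terms of the Beatty sequence `⌊m φ⌋`, up to additive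
constants, are separated by an invariant taking `2 n + 1` values. -/
lemma exists_floor_pattern_invariant (n : ℕ) : ∃ S : ℤ → Fin (2 * n + 1), ∀ m m' : ℤ,
    S m = S m' → ∀ j : ℤ, |j| ≤ n →
      ⌊((m + j : ℤ) : ℝ) * goldenRatio⌋ - ⌊(m : ℝ) * goldenRatio⌋ =
        ⌊((m' + j : ℤ) : ℝ) * goldenRatio⌋ - ⌊(m' : ℝ) * goldenRatio⌋ := by
  set t : ℤ → ℤ → ℤ := fun m j => ⌊Int.fract (m * goldenRatio) + j * goldenRatio⌋ with ht
  have hdiff (m j : ℤ) : ⌊((m + j : ℤ) : ℝ) * goldenRatio⌋ - ⌊(m : ℝ) * goldenRatio⌋ = t m j := by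
    simp only [ht, Int.fract]
    rw [show (m : ℝ) * goldenRatio - ⌊(m : ℝ) * goldenRatio⌋ + j * goldenRatio =
      ((m + j : ℤ) : ℝ) * goldenRatio - ⌊(m : ℝ) * goldenRatio⌋ by push_cast; ring,
      Int.floor_sub_intCast]
  have hlow (m j : ℤ) : ⌊j * goldenRatio⌋ ≤ t m j :=
    Int.floor_mono (by linarith [Int.fract_nonneg (m * goldenRatio)])
  have hup (m j : ℤ) : t m j ≤ ⌊j * goldenRatio⌋ + 1 := by
    rw [← Int.floor_add_one]
    exact Int.floor_mono (by linarith [Int.fract_lt_one (m * goldenRatio)])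
  have hzero (m : ℤ) : t m 0 = 0 := by
    simp [ht]
  set I : Finset ℤ := Finset.Icc (-n : ℤ) n with hI
  -- Each summand is `0` or `1` and is monotone in `⟨m φ⟩`, so equal sums force equal summands. The
  -- term `j = 0` vanishes, which leaves `2 n + 1` possible values.
  set S : ℤ → ℤ := fun m => ∑ j ∈ I, (t m j - ⌊j * goldenRatio⌋) with hS
  have hS0 (m : ℤ) : 0 ≤ S m := Finset.sum_nonneg fun j _ => sub_nonneg.2 (hlow m j)
  have hS1 (m : ℤ) : S m ≤ 2 * n := by
    have h0 : (0 : ℤ) ∈ I := by simp [hI]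
    have hcard : ((I.erase 0).card : ℤ) = 2 * n := by
      rw [Finset.card_erase_of_mem h0, hI, Int.card_Icc]
      omega
    calc S m = ∑ j ∈ I.erase 0, (t m j - ⌊j * goldenRatio⌋) := by
          simp only [hS]
          rw [← Finset.add_sum_erase _ _ h0, hzero]
          simp
      _ ≤ ∑ j ∈ I.erase 0, 1 := Finset.sum_le_sum fun j _ => by linarith [hup m j]
      _ = 2 * n := by rw [Finset.sum_const, nsmul_one, hcard]
  have hmain (m m' : ℤ) (hle : Int.fract (m * goldenRatio) ≤ Int.fract (m' * goldenRatio))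
      (heq : S m = S m') (j : ℤ) (hj : j ∈ I) : t m j = t m' j := by
    have hmono : ∀ j ∈ I, t m j - ⌊j * goldenRatio⌋ ≤ t m' j - ⌊j * goldenRatio⌋ :=
      fun j _ => sub_le_sub_right (Int.floor_mono (by linarith)) _
    have := (Finset.sum_eq_sum_iff_of_le hmono).1 heq j hj
    omega
  refine ⟨fun m => ⟨(S m).toNat, by have := hS0 m; have := hS1 m; omega⟩, fun m m' h j hj => ?_⟩
  have heq : S m = S m' := by
    have h' := congrArg Fin.val h
    have := hS0 m; have := hS0 m'
    simp only at h'
    omega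
  have hj' : j ∈ I := by rw [hI, Finset.mem_Icc]; exact abs_le.1 hj
  rw [hdiff, hdiff]
  rcases le_total (Int.fract (m * goldenRatio)) (Int.fract (m' * goldenRatio)) with hle | hle
  · exact hmain m m' hle heq j hj'
  · exact (hmain m' m hle heq.symm j hj').symm

/-! ### The displaced lattice -/

/-- The displaced lattice point `m + δ ⟨m φ⟩`. -/
noncomputable def point (δ : ℝ) (m : ℤ) : ℝ := m + δ * Int.fract ((m : ℝ) * goldenRatio)

/-- The displaced lattice `{m + δ ⟨m φ⟩ : m ∈ ℤ}`. -/
def lattice (δ : ℝ) : Set ℝ := {y : ℝ | ∃ m : ℤ, y = point δ m}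

lemma point_mem (δ : ℝ) (m : ℤ) : point δ m ∈ lattice δ := ⟨m, rfl⟩

lemma point_zero (δ : ℝ) : point δ 0 = 0 := by simp [point]

variable {δ : ℝ}

lemma le_point (hδ : 0 < δ) (m : ℤ) : (m : ℝ) ≤ point δ m := by
  have := mul_nonneg hδ.le (Int.fract_nonneg ((m : ℝ) * goldenRatio))
  unfold point; linarith

lemma point_lt (hδ : 0 < δ) (m : ℤ) : point δ m < m + δ := by
  have := mul_lt_mul_of_pos_left (Int.fract_lt_one ((m : ℝ) * goldenRatio)) hδ
  unfold point; linarith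

/-- Differences of points are governed by the Beatty sequence. -/
lemma point_add_sub (m j : ℤ) : point δ (m + j) - point δ m =
    j + δ * (j * goldenRatio -
      ((⌊((m + j : ℤ) : ℝ) * goldenRatio⌋ - ⌊(m : ℝ) * goldenRatio⌋ : ℤ) : ℝ)) := by
  simp only [point, Int.fract]
  push_cast
  ring

/-! ### Patch counting and repetitivity -/

/-- A point at distance less than `T` from `point δ m` has index within less than `T + δ ≤ n + 1` of
`m`, so the increments with `|j| ≤ n` determine the patch. -/
lemma patchEquiv_of_floor (hδ : 0 < δ) {T : ℝ} {n : ℕ} (hn : T + δ ≤ n + 1) {m m' : ℤ}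
    (h : ∀ j : ℤ, |j| ≤ n →
      ⌊((m + j : ℤ) : ℝ) * goldenRatio⌋ - ⌊(m : ℝ) * goldenRatio⌋ =
        ⌊((m' + j : ℤ) : ℝ) * goldenRatio⌋ - ⌊(m' : ℝ) * goldenRatio⌋) :
    PatchEquiv (lattice δ) T (point δ m) (point δ m') := by
  have hsmall (m i : ℤ) (hi : |point δ i - point δ m| < T) : |i - m| ≤ n := by
    have h1 := le_point hδ i
    have h2 := le_point hδ m
    have h3 := point_lt hδ i
    have h4 := point_lt hδ m
    rw [abs_lt] at hi
    have h5 : ((i - m : ℤ) : ℝ) < n + 1 := by push_cast; linarith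
    have h6 : -((n : ℝ) + 1) < ((i - m : ℤ) : ℝ) := by push_cast; linarith
    rw [abs_le]
    constructor
    · have : -((n : ℤ) + 1) < i - m := by exact_mod_cast h6
      omega
    · have : i - m < (n : ℤ) + 1 := by exact_mod_cast h5
      omega
  have hdiff (j : ℤ) (hj : |j| ≤ n) :
      point δ (m + j) - point δ m = point δ (m' + j) - point δ m' := by
    rw [point_add_sub, point_add_sub, h j hj]
  ext z
  simp only [patch, Set.mem_vadd_set, vadd_eq_add, Set.mem_inter_iff, Metric.mem_ball,
    Real.dist_eq]
  constructor
  · rintro ⟨⟨i, rfl⟩, hi⟩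
    have hj := hdiff (i - m') (hsmall m' i hi)
    rw [add_sub_cancel] at hj
    refine ⟨point δ (m + (i - m')), ⟨point_mem δ _, ?_⟩, by linarith⟩
    rwa [hj]
  · rintro ⟨_, ⟨⟨i, rfl⟩, hi⟩, rfl⟩
    have hj := hdiff (i - m) (hsmall m i hi)
    rw [add_sub_cancel] at hj
    refine ⟨⟨m' + (i - m), by linarith⟩, ?_⟩
    rwa [show point δ m' - point δ m + point δ i - point δ m' = point δ i - point δ m by ring]

/-- If every window of `F` consecutive integers contains an index with property `p`, then every
closed interval of radius `(F + δ) / 2` contains a point whose index has property `p`. -/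
lemma exists_edist_point_le (hδ : 0 < δ) (F : ℕ) {p : ℤ → Prop}
    (hp : ∀ a : ℤ, ∃ m, a ≤ m ∧ m < a + F ∧ p m) (c : ℝ) :
    ∃ m, p m ∧ edist (point δ m) c ≤ ENNReal.ofReal ((F + δ) / 2) := by
  -- A point lies less than `δ` to the right of its index, so the window starts at the left end of
  -- the target interval and the radius absorbs the extra `δ`.
  obtain ⟨m, h1, h2, h3⟩ := hp ⌈c - (F + δ) / 2⌉
  refine ⟨m, h3, ?_⟩
  rw [edist_dist, Real.dist_eq]
  apply ENNReal.ofReal_le_ofReal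
  have e1 := le_point hδ m
  have e2 := point_lt hδ m
  have e3 := Int.ceil_lt_add_one (c - (F + δ) / 2)
  have e4 : c - (F + δ) / 2 ≤ m := (Int.le_ceil _).trans (by exact_mod_cast h1)
  have e5 : (m : ℝ) + 1 ≤ ⌈c - (F + δ) / 2⌉ + F := by exact_mod_cast h2
  rw [abs_le]
  constructor <;> linarith

lemma exists_edist_mem_le (hδ : 0 < δ) (c : ℝ) :
    ∃ y ∈ lattice δ, edist y c ≤ ENNReal.ofReal ((1 + δ) / 2) := by
  obtain ⟨m, -, hm⟩ := exists_edist_point_le hδ 1 (p := fun _ => True)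
    (fun a => ⟨a, le_rfl, by simp, trivial⟩) c
  exact ⟨_, point_mem δ m, by simpa using hm⟩

lemma coveringRadius_le (hδ : 0 < δ) :
    coveringRadius (lattice δ) ≤ ENNReal.ofReal ((1 + δ) / 2) :=
  sInf_le fun c => exists_edist_mem_le hδ c

lemma patchCount_le (hδ : 0 < δ) {T : ℝ} {n : ℕ} (hn : T + δ ≤ n + 1) :
    patchCount (lattice δ) T ≤ (2 * n + 1 : ℕ) := by
  obtain ⟨S, hS⟩ := exists_floor_pattern_invariant n
  choose i hi using fun y : lattice δ => y.2
  have hinj : Function.Injective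
      (fun q : Quotient (patchSetoid (lattice δ) T) => S (i q.out)) := by
    intro q q' h
    rw [← q.out_eq, ← q'.out_eq]
    apply Quotient.sound
    change PatchEquiv _ _ _ _
    rw [hi q.out, hi q'.out]
    exact patchEquiv_of_floor hδ hn (hS _ _ h)
  have := ENat.card_le_card_of_injective hinj
  simpa [patchCount] using this

lemma repetitivity_le_of_fib (hδ : 0 < δ) {T : ℝ} {n k : ℕ} (hn : T + δ ≤ n + 1)
    (hk : 2 * n < Nat.fib (k + 1)) :
    repetitivity (lattice δ) T ≤ ENNReal.ofReal ((Nat.fib (k + 2) + δ) / 2) := by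
  apply sInf_le
  rintro c _ ⟨m, rfl⟩
  obtain ⟨m', h, hc⟩ := exists_edist_point_le hδ (Nat.fib (k + 2))
    (p := fun m' => PatchEquiv (lattice δ) T (point δ m) (point δ m')) (fun a => by
      obtain ⟨m', q, h1, h2, h3⟩ := exists_floor_pattern_recurs n k hk m a
      refine ⟨m', h1, h2, patchEquiv_of_floor hδ hn fun j hj => ?_⟩
      have e0 := h3 0 (by simp)
      rw [add_zero, add_zero] at e0
      rw [h3 j hj, e0]
      ring) c
  exact ⟨_, point_mem δ m', hc, h⟩

/-- Take `fib k` to be the largest Fibonacci number with `fib k ≤ 2 n`. Then `fib (k + 2) = (φ + 1)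
fib k + ψ ^ k ≤ 2 (φ + 1) n + 1`, and halving gives slope `φ + 1`. -/
lemma repetitivity_le (hδ : 0 < δ) (hδ1 : δ ≤ 1) {T : ℝ} (hT : 0 ≤ T) :
    repetitivity (lattice δ) T ≤ ENNReal.ofReal ((goldenRatio + 1) * (T + 1) + 1) := by
  set n := ⌊T⌋₊ + 1 with hn
  have hTn : T + δ ≤ n + 1 := by
    have := Nat.lt_floor_add_one T
    rw [hn]; push_cast; linarith
  have hnT : (n : ℝ) ≤ T + 1 := by
    have := Nat.floor_le hT
    rw [hn]; push_cast; linarith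
  set k := Nat.greatestFib (2 * n)
  refine (repetitivity_le_of_fib hδ hTn (Nat.lt_fib_greatestFib_add_one (2 * n))).trans
    (ENNReal.ofReal_le_ofReal ?_)
  have h1 : (Nat.fib k : ℝ) ≤ 2 * n := by exact_mod_cast Nat.fib_greatestFib_le (2 * n)
  have h2 := fib_succ_sub_goldenRatio_mul_fib k
  have h3 : (Nat.fib (k + 2) : ℝ) = Nat.fib k + Nat.fib (k + 1) := by
    exact_mod_cast Nat.fib_add_two (n := k)
  have h4 : goldenConj ^ k ≤ 1 := by
    refine (le_abs_self _).trans ?_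
    rw [abs_pow, abs_of_neg goldenConj_neg]
    exact pow_le_one₀ neg_goldenConj_pos.le (by linarith [neg_one_lt_goldenConj])
  have h5 := mul_le_mul_of_nonneg_left (h1.trans (mul_le_mul_of_nonneg_left hnT zero_le_two))
    (by linarith [goldenRatio_pos] : 0 ≤ goldenRatio + 1)
  linarith

lemma patchCount_le_linear (hδ : 0 < δ) (hδ1 : δ ≤ 1) {T : ℝ} (hT : 0 ≤ T) :
    (patchCount (lattice δ) T : ℝ≥0∞) ≤ ENNReal.ofReal (2 * T + 3) := by
  have hTn : T + δ ≤ (⌊T⌋₊ + 1 : ℕ) + 1 := by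
    have := Nat.lt_floor_add_one T
    push_cast; linarith
  calc (patchCount (lattice δ) T : ℝ≥0∞)
      ≤ ((2 * (⌊T⌋₊ + 1) + 1 : ℕ) : ℕ∞) := by exact_mod_cast patchCount_le hδ hTn
    _ = ENNReal.ofReal ((2 * (⌊T⌋₊ + 1) + 1 : ℕ) : ℝ) := by
      rw [ENNReal.ofReal_natCast]; rfl
    _ ≤ ENNReal.ofReal (2 * T + 3) := by
      apply ENNReal.ofReal_le_ofReal
      have := Nat.floor_le hT
      push_cast; linarith

/-- Patches of radius at most `1 - δ` are singletons. -/
lemma patchEquiv_of_le (hδ : 0 < δ) {T : ℝ} (hT : T ≤ 1 - δ) (m m' : ℤ) :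
    PatchEquiv (lattice δ) T (point δ m) (point δ m') :=
  patchEquiv_of_floor hδ (n := 0) (by push_cast; linarith) fun j hj => by
    have : j = 0 := by simpa using hj
    simp [this]

lemma patchCount_le_one (hδ : 0 < δ) {T : ℝ} (hT : T ≤ 1 - δ) :
    patchCount (lattice δ) T ≤ 1 := by
  simpa using patchCount_le hδ (n := 0) (T := T) (by push_cast; linarith)

lemma repetitivity_le_of_le (hδ : 0 < δ) {T : ℝ} (hT : T ≤ 1 - δ) :
    repetitivity (lattice δ) T ≤ ENNReal.ofReal ((1 + δ) / 2) := by
  apply sInf_le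
  rintro c _ ⟨m, rfl⟩
  obtain ⟨_, ⟨m', rfl⟩, hc⟩ := exists_edist_mem_le hδ c
  exact ⟨_, point_mem δ m', hc, patchEquiv_of_le hδ hT m m'⟩

/-! ### Aperiodicity, Meyer property, linear repetitivity -/

/-- A period `t` is itself a point, of index `r`. Then `t + point δ (-r)` lies in `[0, 2 δ)`, so it
is the point `0`; hence `⟨r φ⟩ + ⟨-r φ⟩ = 0`, and irrationality gives `r = 0`. -/
lemma isAperiodic (hδ : 0 < δ) (hδ1 : δ < 1 / 2) : IsAperiodic (lattice δ) := by
  intro t ht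
  have hmem (s : ℤ) : t + point δ s ∈ lattice δ := by
    rw [← ht]
    exact Set.vadd_mem_vadd_set (point_mem δ s)
  obtain ⟨r, hr⟩ := hmem 0
  rw [point_zero, add_zero] at hr
  obtain ⟨u, hu⟩ := hmem (-r)
  have hu0 : u = 0 := by
    have h1 := le_point hδ r
    have h2 := point_lt hδ r
    have h3 := le_point hδ (-r)
    have h4 := point_lt hδ (-r)
    have h5 := le_point hδ u
    have h6 := point_lt hδ u
    push_cast at h3 h4
    have h7 : (u : ℝ) < 1 := by linarith
    have h8 : (-1 : ℝ) < u := by linarith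
    have h7' : u < 1 := by exact_mod_cast h7
    have h8' : -1 < u := by exact_mod_cast h8
    omega
  rw [hu0, point_zero, hr] at hu
  have hfr : Int.fract ((r : ℝ) * goldenRatio) = 0 := by
    have h1 := Int.fract_nonneg ((r : ℝ) * goldenRatio)
    have h2 := Int.fract_nonneg (((-r : ℤ) : ℝ) * goldenRatio)
    have h3 : δ * (Int.fract ((r : ℝ) * goldenRatio) +
        Int.fract (((-r : ℤ) : ℝ) * goldenRatio)) = 0 := by
      simp only [point] at hu
      push_cast at hu ⊢
      linarith
    rcases mul_eq_zero.1 h3 with h | h <;> linarith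
  obtain ⟨z, hz⟩ := Int.fract_eq_zero_iff.1 hfr
  have hr0 : r = 0 := by
    by_contra h
    exact (goldenRatio_irrational.intCast_mul h).ne_int z hz.symm
  rw [hr, hr0, point_zero]

/-- A criterion for a set of real numbers to be a Delone set. -/
lemma isDelone_of_real {X : Set ℝ} {r R : ℝ} (hr : 0 < r) (hR : 0 < R)
    (hsep : ∀ x ∈ X, ∀ y ∈ X, x ≠ y → r < |x - y|)
    (hcov : ∀ c : ℝ, ∃ y ∈ X, edist y c ≤ ENNReal.ofReal R) : IsDelone X := by
  refine ⟨⟨X, r.toNNReal, by simpa using hr, ?_, R.toNNReal, by simpa using hR, ?_⟩, rfl⟩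
  · intro x hx y hy hxy
    change ENNReal.ofReal r < edist x y
    rw [edist_dist, Real.dist_eq]
    exact (ENNReal.ofReal_lt_ofReal_iff_of_nonneg hr.le).2 (hsep x hx y hy hxy)
  · intro c _
    obtain ⟨y, hy, hc⟩ := hcov c
    refine ⟨y, hy, ?_⟩
    rw [edist_comm] at hc
    exact hc

lemma isDelone (hδ : 0 < δ) (hδ1 : δ < 1 / 2) : IsDelone (lattice δ) := by
  refine isDelone_of_real (r := 1 / 2) (by norm_num) (by linarith : 0 < (1 + δ) / 2) ?_
    (exists_edist_mem_le hδ)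
  rintro _ ⟨m, rfl⟩ _ ⟨m', rfl⟩ hne
  have h1 := le_point hδ m
  have h2 := point_lt hδ m
  have h3 := le_point hδ m'
  have h4 := point_lt hδ m'
  have hmm : m ≠ m' := fun h => hne (by rw [h])
  rw [lt_abs]
  rcases lt_or_gt_of_ne hmm with h | h
  · have : (m : ℝ) + 1 ≤ m' := by exact_mod_cast h
    right; linarith
  · have : (m' : ℝ) + 1 ≤ m := by exact_mod_cast h
    left; linarith

/-- Differences of points lie in two displaced copies of the lattice. -/
lemma exists_eq_of_mem_sub {z : ℝ} (hz : z ∈ lattice δ - lattice δ) :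
    ∃ k : ℤ, z = point δ k ∨ z = point δ k - δ := by
  obtain ⟨_, ⟨a, rfl⟩, _, ⟨b, rfl⟩, rfl⟩ := hz
  refine ⟨a - b, ?_⟩
  set x := Int.fract ((a : ℝ) * goldenRatio) with hx
  set y := Int.fract ((b : ℝ) * goldenRatio) with hy
  have h1 : x - y = Int.fract (((a - b : ℤ) : ℝ) * goldenRatio) +
      ((⌊((a - b : ℤ) : ℝ) * goldenRatio⌋ - ⌊(a : ℝ) * goldenRatio⌋ +
        ⌊(b : ℝ) * goldenRatio⌋ : ℤ) : ℝ) := by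
    simp only [hx, hy, Int.fract]
    push_cast
    ring
  set w := Int.fract (((a - b : ℤ) : ℝ) * goldenRatio) with hw
  set e := ⌊((a - b : ℤ) : ℝ) * goldenRatio⌋ - ⌊(a : ℝ) * goldenRatio⌋ +
        ⌊(b : ℝ) * goldenRatio⌋
  have x0 : 0 ≤ x := Int.fract_nonneg _
  have x1 : x < 1 := Int.fract_lt_one _
  have y0 : 0 ≤ y := Int.fract_nonneg _
  have y1 : y < 1 := Int.fract_lt_one _
  have w0 : 0 ≤ w := Int.fract_nonneg _
  have w1 : w < 1 := Int.fract_lt_one _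
  have e0 : (e : ℝ) < 1 := by linarith
  have e1 : (-2 : ℝ) < e := by linarith
  have e0' : e < 1 := by exact_mod_cast e0
  have e1' : -2 < e := by exact_mod_cast e1
  simp only [point, ← hx, ← hy, ← hw]
  -- The carry in subtracting fractional parts selects the copy of the lattice.
  rcases (by omega : e = 0 ∨ e = -1) with he | he
  · left
    rw [he] at h1
    push_cast at h1 ⊢
    linear_combination δ * h1
  · right
    rw [he] at h1
    push_cast at h1 ⊢
    linear_combination δ * h1

/-- Differences with the same index `k` are equal or exactly `δ` apart; different indices give a gap
above `1 - 2 δ`. Relative density is inherited because `0` is a point. -/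
lemma isMeyer (hδ : 0 < δ) (hδ1 : δ < 1 / 4) : IsMeyer (lattice δ) := by
  refine ⟨isDelone hδ (by linarith), isDelone_of_real (r := δ / 2) (by linarith)
    (by linarith : 0 < (1 + δ) / 2) ?_ fun c => ?_⟩
  · intro x hx y hy hne
    obtain ⟨k, hk⟩ := exists_eq_of_mem_sub hx
    obtain ⟨l, hl⟩ := exists_eq_of_mem_sub hy
    have h1 := le_point hδ k
    have h2 := point_lt hδ k
    have h3 := le_point hδ l
    have h4 := point_lt hδ l
    rw [lt_abs]
    rcases lt_trichotomy k l with h | rfl | h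
    · have : (k : ℝ) + 1 ≤ l := by exact_mod_cast h
      right; rcases hk with rfl | rfl <;> rcases hl with rfl | rfl <;> linarith
    · rcases hk with rfl | rfl <;> rcases hl with rfl | rfl
      · exact absurd rfl hne
      · left; linarith
      · right; linarith
      · exact absurd rfl hne
    · have : (l : ℝ) + 1 ≤ k := by exact_mod_cast h
      left; rcases hk with rfl | rfl <;> rcases hl with rfl | rfl <;> linarith
  · obtain ⟨y, hy, hc⟩ := exists_edist_mem_le hδ c
    exact ⟨y, ⟨y, hy, 0, ⟨0, (point_zero δ).symm⟩, sub_zero y⟩, hc⟩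

lemma isLinearlyRepetitive (hδ : 0 < δ) (hδ1 : δ ≤ 1) : IsLinearlyRepetitive (lattice δ) := by
  intro T₁ hT₁
  refine ⟨goldenRatio + 1 + (goldenRatio + 3) / T₁, fun T hT => ?_⟩
  -- The bound of `repetitivity_le` is `(φ + 1) T + φ + 2`; the `φ + 3` in the constant makes the
  -- inequality strict.
  have hT0 : 0 < T := hT₁.trans_le hT
  have hφ := goldenRatio_pos
  have h : goldenRatio + 3 ≤ (goldenRatio + 3) / T₁ * T := by
    rw [div_mul_eq_mul_div, le_div_iff₀ hT₁]
    exact mul_le_mul_of_nonneg_left hT (by linarith)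
  refine (repetitivity_le hδ hδ1 hT0.le).trans_lt
    ((ENNReal.ofReal_lt_ofReal_iff_of_nonneg (by positivity)).2 ?_)
  linarith

/-! ### Choice of parameters and conclusion -/

/-- Passing from a bound by real numbers to a bound involving the covering radius. -/
lemma lt_div_coveringRadius (hδ : 0 < δ) {N : ℝ≥0∞} {b a : ℝ} (hb : 0 ≤ b)
    (hN : N ≤ ENNReal.ofReal b) (hba : b * ((1 + δ) / 2) < a) :
    N < ENNReal.ofReal a / coveringRadius (lattice δ) := by
  have hpos : 0 < (1 + δ) / 2 := by linarith
  calc N ≤ ENNReal.ofReal b := hN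
    _ < ENNReal.ofReal (a / ((1 + δ) / 2)) :=
      (ENNReal.ofReal_lt_ofReal_iff_of_nonneg hb).2 ((lt_div_iff₀ hpos).2 hba)
    _ = ENNReal.ofReal a / ENNReal.ofReal ((1 + δ) / 2) := ENNReal.ofReal_div_of_pos hpos
    _ ≤ ENNReal.ofReal a / coveringRadius (lattice δ) :=
      ENNReal.div_le_div_left (coveringRadius_le hδ) _

end DisplacedLattice

open DisplacedLattice in
theorem theorem6p1 (ε : ℝ) (hε : 0 < ε) :
    ∃ (Y : Set ℝ) (δ : ℝ), |δ| < 1 / 2 ∧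
      Y = {y : ℝ | ∃ m : ℤ, y = (m : ℝ) + δ * Int.fract ((m : ℝ) * Real.goldenRatio)} ∧
      IsAperiodic Y ∧ IsMeyer Y ∧ IsLinearlyRepetitive Y ∧
      (∃ Tstar : ℝ, 0 < Tstar ∧
        (patchCount Y Tstar : ℝ≥0∞) <
          ENNReal.ofReal ((1 / 2 + ε) * Tstar) / coveringRadius Y ∧
        repetitivity Y Tstar < ENNReal.ofReal ((1 / 2 + ε) * Tstar)) ∧
      (∃ T₀ : ℝ, 0 < T₀ ∧ ∀ T : ℝ, T₀ < T →
        (patchCount Y T : ℝ≥0∞) < ENNReal.ofReal ((1 + ε) * T) / coveringRadius Y ∧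
        repetitivity Y T < ENNReal.ofReal ((Real.goldenRatio + 1 + ε) * T)) := by
  -- `δ ≤ ε / 4` lets `ε` absorb the factor `1 + δ` from the covering radius; `δ ≤ 1 / 8` keeps `1 -
  -- δ` away from `0` and meets the `1 / 4` needed for the Meyer property.
  obtain ⟨δ, hδ, hδε, hδ8⟩ : ∃ δ : ℝ, 0 < δ ∧ δ ≤ ε / 4 ∧ δ ≤ 1 / 8 :=
    ⟨min (ε / 4) (1 / 8), by positivity, min_le_left _ _, min_le_right _ _⟩
  have hεδ : ε * δ ≤ ε / 8 := by
    linarith [mul_le_mul_of_nonneg_left hδ8 hε.le]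
  have hbound : (1 + δ) / 2 < (1 / 2 + ε) * (1 - δ) := by linarith
  -- `1 - δ` is the largest radius for which `patchEquiv_of_le` applies. Beyond `6 / ε` one has `ε T
  -- > 6`, which dominates the additive constants in both linear bounds.
  refine ⟨lattice δ, δ, by rw [abs_of_pos hδ]; linarith, rfl, isAperiodic hδ (by linarith),
    isMeyer hδ (by linarith), isLinearlyRepetitive hδ (by linarith),
    ⟨1 - δ, by linarith, ?_, ?_⟩, ⟨6 / ε, by positivity, fun T hT => ⟨?_, ?_⟩⟩⟩
  · refine lt_div_coveringRadius hδ zero_le_one ?_ (by linarith)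
    rw [ENNReal.ofReal_one]
    exact_mod_cast patchCount_le_one hδ le_rfl
  · exact (repetitivity_le_of_le hδ le_rfl).trans_lt
      ((ENNReal.ofReal_lt_ofReal_iff_of_nonneg (by linarith)).2 hbound)
  all_goals
    have hT0 : 0 < T := lt_trans (by positivity) hT
    have hεT : 6 < ε * T := by rwa [div_lt_iff₀' hε] at hT
  · have hδT : δ * T ≤ ε / 4 * T := mul_le_mul_of_nonneg_right hδε hT0.le
    exact lt_div_coveringRadius hδ (by linarith) (patchCount_le_linear hδ (by linarith) hT0.le)
      (by linarith)
  · have hφ := Real.goldenRatio_pos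
    have hφ2 := Real.goldenRatio_lt_two
    refine (repetitivity_le hδ (by linarith) hT0.le).trans_lt
      ((ENNReal.ofReal_lt_ofReal_iff_of_nonneg (by positivity)).2 (by linarith))
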